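/- Let $\Bbbk$ be a field. Let $\Delta G$ be a crossed simplicial group: a category with the same objects $[n]$ ($n\ge 0$) as the simplex category $\Delta$, containing $\Delta$, together with groups $G_n$ such that $\mathrm{Aut}_{\Delta G}([n])\cong G_n^{op}$ and every morphism $[m]\to[n]$ of $\Delta G$ can be written uniquely as $\varphi\circ g$ with $\varphi\in\mathrm{Hom}_\Delta([m],[n])$ and $g\in G_m^{op}=\mathrm{Aut}_{\Delta G}([m])$. Let $\Bbbk\Delta$ and $\Bbbk\Delta G$ be the categorical algebras (formal $\Bbbk$-linear combinations of morphisms), and let $\mathrm{Mod}\text{-}\Delta$ and $\mathrm{Mod}\text{-}\Delta G$ be the categories of right modules, i.e. of contravariant functors from $\Delta$, resp. $\Delta G$, to $\Bbbk$-vector spaces; so $\mathrm{Mod}\text{-}\Delta$ is the category of simplicial $\Bbbk$-vector spaces. There is an algebra epimorphism $p\colon \Bbbk\Delta G\to\Bbbk\Delta$ which restricts to the identity on $\Bbbk\Delta$. For such a $p$ let $\mathrm{Res}\colon \mathrm{Mod}\text{-}\Delta\to\mathrm{Mod}\text{-}\Delta G$ be the restriction along $p$, and let $\mathrm{CoInd}=\mathrm{Hom}_{\Delta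 G}(\Delta,\,\cdot\,)\colon \mathrm{Mod}\text{-}\Delta G\to\mathrm{Mod}\text{-}\Delta$ be its right adjoint. $\mathrm{Mod}\text{-}\Delta$ has a model structure in which the cofibrations are the monomorphisms, the weak equivalences are the morphisms that induce isomorphisms on all homotopy groups (the homology groups of the normalized Moore complexes), and the fibrations are the morphisms with the right lifting property against all trivial cofibrations. For every $p$ as above, $\mathrm{Mod}\text{-}\Delta G$ has the model structure transferred from it along $\mathrm{CoInd}$: a morphism $f$ is a weak equivalence, resp. a fibration, if and only if $\mathrm{CoInd}(f)$ is one, and the cofibrations are the morphisms with the left lifting property against all trivial fibrations. With these model structures, $(\mathrm{Res},\mathrm{CoInd})$ is a Quillen equivalence between $\mathrm{Mod}\text{-}\Delta$ and $\mathrm{Mod}\text{-}\Delta G$: $\mathrm{Res}$ preserves cofibrations and trivial cofibrations, and for all cofibrant $X$ in $\mathrm{Mod}\text{-}\Delta$ and fibrant $Y$ in $\mathrm{Mod}\text{-}\Delta G$, a morphism $\mathrm{Res}\,X\to Y$ is a weak equivalence if and only if the adjoint morphism $X\to\mathrm{CoInd}\,Y$ is a weak equivalence. -/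

import Mathlib

open CategoryTheory Opposite HomotopicalAlgebra

universe v u

noncomputable section

/-! ### Categorical algebras

The categorical algebra of a category `C` over `k` is given as the `k`-linear category `Free k C`,
in which the morphisms are the formal `k`-linear combinations of morphisms of `C`. -/

section

variable {k : Type u} [CommRing k] {C : Type*} [Category* C]

variable (k) in
/-- A morphism of `C` as an element of the categorical algebra of `C`. -/
def freeHom {m n : C} (φ : m ⟶ n) : Free.of k m ⟶ Free.of k n :=
  (Finsupp.single φ 1 : (m ⟶ n) →₀ k)

lemma freeHom_id (m : C) : freeHom k (𝟙 m) = 𝟙 (Free.of k m) := rfl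

lemma freeHom_comp {l m n : C} (φ : l ⟶ m) (ψ : m ⟶ n) :
    freeHom k (φ ≫ ψ) = freeHom k φ ≫ freeHom k ψ :=
  (Free.embedding k C).map_comp φ ψ

lemma free_induction {m n : C} {P : (Free.of k m ⟶ Free.of k n) → Prop} (zero : P 0)
    (add : ∀ a b, P a → P b → P (a + b)) (smul : ∀ (r : k) a, P a → P (r • a))
    (of : ∀ φ : m ⟶ n, P (freeHom k φ)) (a : Free.of k m ⟶ Free.of k n) : P a :=
  Finsupp.induction_linear (ι := m ⟶ n) (M := k) (motive := P) a zero add fun φ r =>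
    have h : r • (Finsupp.single φ 1 : (m ⟶ n) →₀ k) = Finsupp.single φ r := by
      rw [Finsupp.smul_single, smul_eq_mul, mul_one]
    Eq.subst (motive := P) h (smul r _ (of φ))

end

/-! ### Crossed simplicial groups -/

/-- The objects `[0], [1], [2], …` of a crossed simplicial group, i.e. a copy of the set of objects
of the simplex category which does not carry the category structure of the latter. -/
structure CrossedObj : Type where
  /-- the underlying object of the simplex category -/
  as : SimplexCategory

/-- A crossed simplicial group `ΔG`: a category with the same objects as `Δ` which contains `Δ`,
such that the automorphism group of `[n]` is `Gₙᵒᵖ`, and such that every morphism `[m] ⟶ [n]` can be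
written in a unique way as `φ ∘ g` with `φ : [m] ⟶ [n]` in `Δ` and `g ∈ Gₘᵒᵖ = Aut [m]`. -/
structure CrossedSimplicialGroup where
  /-- the category structure of `ΔG` -/
  [category : Category.{v} CrossedObj]
  /-- the sequence of groups `Gₙ` -/
  G : ℕ → Type v
  [group : ∀ n, Group (G n)]
  /-- the inclusion of `Δ` in `ΔG`, on morphisms -/
  incl {m n : SimplexCategory} (φ : m ⟶ n) : CrossedObj.mk m ⟶ CrossedObj.mk n
  incl_id (n : SimplexCategory) : incl (𝟙 n) = 𝟙 (CrossedObj.mk n)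
  incl_comp {l m n : SimplexCategory} (φ : l ⟶ m) (ψ : m ⟶ n) : incl (φ ≫ ψ) = incl φ ≫ incl ψ
  /-- the automorphism group of `[n]` -/
  aut (n : SimplexCategory) : Aut (CrossedObj.mk n) ≃* (G n.len)ᵐᵒᵖ
  factorization {m n : SimplexCategory} (f : CrossedObj.mk m ⟶ CrossedObj.mk n) :
    ∃! x : (m ⟶ n) × G m.len, f = ((aut m).symm (MulOpposite.op x.2)).hom ≫ incl x.1

namespace CrossedSimplicialGroup

/-- The category `ΔG` (type synonym, so that the category structure is found by inference). -/
def Cat (_ : CrossedSimplicialGroup.{v}) : Type := CrossedObj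

instance (D : CrossedSimplicialGroup.{v}) : Category.{v} D.Cat := D.category

/-- The object `[n]` of `ΔG`. -/
def of (D : CrossedSimplicialGroup.{v}) (n : SimplexCategory) : D.Cat := CrossedObj.mk n

/-- The object of `Δ` which corresponds to an object of `ΔG`. -/
def Cat.as {D : CrossedSimplicialGroup.{v}} (c : D.Cat) : SimplexCategory := CrossedObj.as c

/-- The inclusion functor from `Δ` to `ΔG`. -/
def inclusion (D : CrossedSimplicialGroup.{v}) : SimplexCategory ⥤ D.Cat where
  obj n := D.of n
  map φ := D.incl φ
  map_id n := D.incl_id n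
  map_comp φ ψ := D.incl_comp φ ψ

/-- An epimorphism from the categorical algebra of `ΔG` to the categorical algebra of `Δ` over `k`
which is the identity on the subalgebra given by `Δ` (in particular on the idempotents `id_[n]`).
The categorical algebras are given as the `k`-linear categories `Free k ΔG` and `Free k Δ`, in which
the morphisms are the formal `k`-linear combinations of morphisms. -/
structure Projection (D : CrossedSimplicialGroup.{v}) (k : Type u) [Field k] where
  /-- the algebra morphism, in each bidegree -/
  map {c d : D.Cat} : (Free.of k c ⟶ Free.of k d) →ₗ[k] (Free.of k c.as ⟶ Free.of k d.as)
  map_id (c : D.Cat) : map (𝟙 (Free.of k c)) = 𝟙 (Free.of k c.as)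
  map_comp {c d e : D.Cat} (a : Free.of k c ⟶ Free.of k d) (b : Free.of k d ⟶ Free.of k e) :
    map (a ≫ b) = map a ≫ map b
  map_incl {m n : SimplexCategory} (φ : m ⟶ n) :
    map (freeHom k (D.inclusion.map φ)) = freeHom k φ

/-- Right `ΔG`-modules over `k`: contravariant functors from `ΔG` to `k`-vector spaces. -/
abbrev Mod (D : CrossedSimplicialGroup.{v}) (k : Type u) [Field k] :=
  D.Catᵒᵖ ⥤ ModuleCat.{u} k

end CrossedSimplicialGroup

/-- Right `Δ`-modules over `k`: simplicial `k`-vector spaces. -/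
abbrev SimplicialVect (k : Type u) [Field k] := SimplicialObject (ModuleCat.{u} k)

namespace SimplicialVect

variable {k : Type u} [Field k] (X : SimplicialVect k)

/-- The right action of the categorical algebra of `Δ` on a simplicial vector space: the `k`-linear
map which sends a morphism `φ` of `Δ` to the induced map `X φ`. -/
def act {m n : SimplexCategory} :
    (Free.of k m ⟶ Free.of k n) →ₗ[k] (X.obj (op n) ⟶ X.obj (op m)) :=
  Finsupp.linearCombination k fun φ : m ⟶ n => X.map φ.op

lemma act_freeHom {m n : SimplexCategory} (φ : m ⟶ n) : act X (freeHom k φ) = X.map φ.op :=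
  (Finsupp.linearCombination_single k 1 φ).trans (one_smul _ _)

lemma act_id (n : SimplexCategory) : act X (𝟙 (Free.of k n)) = 𝟙 _ := by
  rw [← freeHom_id, act_freeHom, op_id, CategoryTheory.Functor.map_id]

lemma act_comp {l m n : SimplexCategory} (a : Free.of k l ⟶ Free.of k m)
    (b : Free.of k m ⟶ Free.of k n) : act X (a ≫ b) = act X b ≫ act X a := by
  induction a using free_induction with
  | zero => rw [Limits.zero_comp, map_zero, map_zero, Limits.comp_zero]
  | add a₁ a₂ h₁ h₂ => rw [Preadditive.add_comp, map_add, map_add, Preadditive.comp_add, h₁, h₂]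
  | smul r a h => rw [Linear.smul_comp, map_smul, map_smul, Linear.comp_smul, h]
  | of φ =>
    induction b using free_induction with
    | zero => rw [Limits.comp_zero, map_zero, map_zero, Limits.zero_comp]
    | add b₁ b₂ h₁ h₂ => rw [Preadditive.comp_add, map_add, map_add, Preadditive.add_comp, h₁, h₂]
    | smul r b h => rw [Linear.comp_smul, map_smul, map_smul, Linear.smul_comp, h]
    | of ψ =>
      rw [← freeHom_comp, act_freeHom, act_freeHom, act_freeHom, op_comp,
        CategoryTheory.Functor.map_comp]

lemma act_naturality {X Y : SimplicialVect k} (f : X ⟶ Y) {m n : SimplexCategory}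
    (a : Free.of k m ⟶ Free.of k n) :
    act X a ≫ f.app (op m) = f.app (op n) ≫ act Y a := by
  induction a using free_induction with
  | zero => rw [map_zero, map_zero, Limits.zero_comp, Limits.comp_zero]
  | add a₁ a₂ h₁ h₂ => rw [map_add, map_add, Preadditive.add_comp, Preadditive.comp_add, h₁, h₂]
  | smul r a h => rw [map_smul, map_smul, Linear.smul_comp, Linear.comp_smul, h]
  | of φ => rw [act_freeHom, act_freeHom, f.naturality]

end SimplicialVect

/-! ### Restriction and coinduction along an epimorphism `ΔG → Δ` -/

namespace CrossedSimplicialGroup.Projection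

variable {D : CrossedSimplicialGroup.{v}} {k : Type u} [Field k] (p : D.Projection k)

/-- The functor from `ΔG` to the categorical algebra of `Δ` given by `p`. -/
def functor : D.Cat ⥤ Free k SimplexCategory where
  obj c := Free.of k c.as
  map f := p.map (freeHom k f)
  map_id c := by rw [freeHom_id]; exact p.map_id c
  map_comp f g := by rw [freeHom_comp]; exact p.map_comp _ _

/-- The restriction functor: a simplicial vector space is considered as a `ΔG`-module
via the epimorphism `p`. -/
def res : SimplicialVect k ⥤ D.Mod k where
  obj X :=
    { obj := fun c => X.obj (op c.unop.as)
      map := fun f => SimplicialVect.act X (p.functor.map f.unop)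
      map_id := fun c => by
        rw [unop_id, CategoryTheory.Functor.map_id]; exact SimplicialVect.act_id X _
      map_comp := fun f g => by
        rw [unop_comp, CategoryTheory.Functor.map_comp]; exact SimplicialVect.act_comp X _ _ }
  map f :=
    { app := fun c => f.app (op c.unop.as)
      naturality := fun _ _ g => SimplicialVect.act_naturality f (p.functor.map g.unop) }

/-- The categorical algebra of `Δ` as a `(Δ, ΔG)`-bimodule via `p`: the covariant functor which
sends `[n]` to the right `ΔG`-module of all linear combinations of morphisms of `Δ` to `[n]`. -/
def bimodule : SimplexCategory ⥤ D.Mod k :=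
  Free.embedding k SimplexCategory ⋙ linearYoneda k (Free k SimplexCategory) ⋙
    (Functor.whiskeringLeft _ _ _).obj p.functor.op

/-- The coinduction functor `Y ↦ Hom_{ΔG}(Δ, Y)`. -/
def coind : D.Mod k ⥤ SimplicialVect k :=
  linearYoneda k (D.Mod k) ⋙ (Functor.whiskeringLeft _ _ _).obj p.bimodule.op

lemma bimodule_hom_ext {n : SimplexCategory} {Y : D.Mod k} {ψ ψ' : p.bimodule.obj n ⟶ Y}
    (h : ∀ (c : D.Catᵒᵖ) (a : Free.of k c.unop.as ⟶ Free.of k n),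
      (ψ.app c).hom a = (ψ'.app c).hom a) : ψ = ψ' := by
  ext c a
  exact h c a

/-- The right action of the categorical algebra of `Δ` on `CoInd Y = Hom_{ΔG}(Δ, Y)` is induced by
the left multiplication on `Δ`. -/
lemma coind_act_apply (Y : D.Mod k) {m n : SimplexCategory} (a : Free.of k m ⟶ Free.of k n)
    (ψ : p.bimodule.obj n ⟶ Y) (c : D.Catᵒᵖ) (b : Free.of k c.unop.as ⟶ Free.of k m) :
    (((SimplicialVect.act (p.coind.obj Y) a).hom ψ : p.bimodule.obj m ⟶ Y).app c).hom b =
      (ψ.app c).hom (b ≫ a) := by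
  induction a using free_induction with
  | zero =>
    refine (congrArg (fun h => ((h.hom ψ : p.bimodule.obj m ⟶ Y).app c).hom b)
      (map_zero (SimplicialVect.act (p.coind.obj Y)))).trans ?_
    exact ((congrArg (fun x => (ψ.app c).hom x) (Limits.comp_zero (f := b))).trans
      (map_zero (ψ.app c).hom)).symm
  | add a₁ a₂ h₁ h₂ =>
    refine (congrArg (fun h => ((h.hom ψ : p.bimodule.obj m ⟶ Y).app c).hom b)
      (map_add (SimplicialVect.act (p.coind.obj Y)) a₁ a₂)).trans ?_
    refine (congrArg₂ (· + ·) h₁ h₂).trans ?_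
    exact ((congrArg (fun x => (ψ.app c).hom x) (Preadditive.comp_add _ _ _ b a₁ a₂)).trans
      (map_add (ψ.app c).hom (b ≫ a₁) (b ≫ a₂))).symm
  | smul r a h =>
    refine (congrArg (fun h => ((h.hom ψ : p.bimodule.obj m ⟶ Y).app c).hom b)
      (map_smul (SimplicialVect.act (p.coind.obj Y)) r a)).trans ?_
    refine (congrArg (r • ·) h).trans ?_
    exact ((congrArg (fun x => (ψ.app c).hom x) (Linear.comp_smul _ _ _ b r a)).trans
      (map_smul (ψ.app c).hom r (b ≫ a))).symm
  | of φ =>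
    exact congrArg (fun h => ((h.hom ψ : p.bimodule.obj m ⟶ Y).app c).hom b)
      (SimplicialVect.act_freeHom (p.coind.obj Y) φ)

/-- The unit `X ⟶ CoInd (Res X)`: an element `x` of `Xₙ` is sent to the map `Δ → X`, `a ↦ x a`. -/
def unit : 𝟭 (SimplicialVect k) ⟶ p.res ⋙ p.coind where
  app X :=
    { app := fun n => ModuleCat.ofHom
        { toFun := fun x =>
            { app := fun c => ModuleCat.ofHom
                { toFun := fun (a : Free.of k c.unop.as ⟶ Free.of k n.unop) =>
                    (SimplicialVect.act X a).hom x
                  map_add' := fun a b =>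
                    congrArg (fun h => h.hom x) (map_add (SimplicialVect.act X) a b)
                  map_smul' := fun r a =>
                    congrArg (fun h => h.hom x) (map_smul (SimplicialVect.act X) r a) }
              naturality := fun c d g => by
                ext a
                exact congrArg (fun h => h.hom x)
                  (SimplicialVect.act_comp X (p.functor.map g.unop) a) }
          map_add' := fun x y => by
            ext c a
            exact (SimplicialVect.act X a).hom.map_add x y
          map_smul' := fun r x => by
            ext c a
            exact (SimplicialVect.act X a).hom.map_smul r x }
      naturality := fun m n φ => by
        ext x
        refine p.bimodule_hom_ext fun c a => ?_
        refine (congrArg (fun h => (SimplicialVect.act X a).hom (h.hom x))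
          (SimplicialVect.act_freeHom X φ.unop)).symm.trans ?_
        exact (congrArg (fun h => h.hom x)
          (SimplicialVect.act_comp X a (freeHom k φ.unop))).symm }
  naturality X Y f := by
    ext n x
    refine p.bimodule_hom_ext fun c a => ?_
    exact (congrArg (fun h => h.hom x) (SimplicialVect.act_naturality f a)).symm

/-- The counit `Res (CoInd Y) ⟶ Y`, which is the evaluation of maps `Δ → Y` at the identities. -/
def counit : p.coind ⋙ p.res ⟶ 𝟭 (D.Mod k) where
  app Y :=
    { app := fun c => ModuleCat.ofHom
        { toFun := fun (ψ : p.bimodule.obj c.unop.as ⟶ Y) =>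
            (ψ.app c).hom (𝟙 (Free.of k c.unop.as))
          map_add' := fun _ _ => rfl
          map_smul' := fun _ _ => rfl }
      naturality := fun c d g => by
        ext ψ
        refine (p.coind_act_apply Y (p.functor.map g.unop) ψ d (𝟙 _)).trans ?_
        refine (congrArg (fun b => (ψ.app d).hom b) ((Category.id_comp _).trans
          (Category.comp_id (p.functor.map g.unop)).symm)).trans ?_
        exact congrArg (fun h => h.hom (𝟙 (Free.of k c.unop.as))) (ψ.naturality g) }
  naturality Y Z f := by
    ext c ψ
    rfl

/-- The adjunction between restriction and coinduction. -/
def adj : p.res ⊣ p.coind where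
  unit := p.unit
  counit := p.counit
  left_triangle_components X := by
    ext c x
    exact congrArg (fun h => h.hom x) (SimplicialVect.act_id X c.unop.as)
  right_triangle_components Y := by
    ext n ψ
    refine p.bimodule_hom_ext fun c a => ?_
    exact (p.coind_act_apply Y a ψ c (𝟙 _)).trans
      (congrArg (fun b => (ψ.app c).hom b) (Category.id_comp a))

end CrossedSimplicialGroup.Projection

/-! ### Model structures and Quillen equivalences -/

/-- The weak equivalences of simplicial vector spaces: the morphisms which induce isomorphisms on
the homotopy groups, i.e. on the homology of the normalized Moore complexes. -/
def simplicialWeakEquivalences (k : Type u) [Field k] : MorphismProperty (SimplicialVect k) :=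
  fun _ _ f => QuasiIso ((AlgebraicTopology.normalizedMooreComplex (ModuleCat.{u} k)).map f)

/-- The standard model structure on simplicial vector spaces: the cofibrations are the
monomorphisms, the weak equivalences are the morphisms which induce isomorphisms on homotopy groups,
the fibrations are the morphisms with the right lifting property against trivial cofibrations. -/
structure IsStandardModelStructure {k : Type u} [Field k] (M : ModelCategory (SimplicialVect k)) :
    Prop where
  cofibrations_eq : cofibrations (SimplicialVect k) = MorphismProperty.monomorphisms _
  weakEquivalences_eq : weakEquivalences (SimplicialVect k) = simplicialWeakEquivalences k
  fibrations_eq : fibrations (SimplicialVect k) =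
    (MorphismProperty.monomorphisms _ ⊓ simplicialWeakEquivalences k).rlp

/-- A model structure `N` on `E` is transferred from `C` along `R : E ⥤ C`: a morphism is a weak
equivalence, resp. a fibration, if and only if its image under `R` is, and the cofibrations are
the morphisms with the left lifting property against trivial fibrations. -/
structure IsTransferred {C E : Type*} [Category* C] [Category* E] (M : ModelCategory C)
    (N : ModelCategory E) (R : E ⥤ C) : Prop where
  weakEquivalences_eq : weakEquivalences E = (weakEquivalences C).inverseImage R
  fibrations_eq : fibrations E = (fibrations C).inverseImage R
  cofibrations_eq : cofibrations E = (trivialFibrations E).llp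

/-- An adjunction `L ⊣ R` between model categories is a Quillen equivalence: `L` preserves
cofibrations and trivial cofibrations, and for all cofibrant `X` and all fibrant `Y`, a morphism
`L X ⟶ Y` is a weak equivalence if and only if the adjoint morphism `X ⟶ R Y` is. -/
structure IsQuillenEquivalence {C E : Type*} [Category* C] [Category* E] (M : ModelCategory C)
    (N : ModelCategory E) {L : C ⥤ E} {R : E ⥤ C} (adj : L ⊣ R) : Prop where
  cofibration_map : cofibrations C ≤ (cofibrations E).inverseImage L
  trivialCofibration_map : trivialCofibrations C ≤ (trivialCofibrations E).inverseImage L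
  weakEquivalence_iff (X : C) (Y : E) [IsCofibrant X] [IsFibrant Y] (f : L.obj X ⟶ Y) :
    WeakEquivalence f ↔ WeakEquivalence (adj.homEquiv X Y f)

end

/-!
The proof has three independent parts.

*The epimorphism `p`.* In `ΔG` the morphisms `[0] ⟶ [n]` are, up to automorphisms of `[0]`, the
vertices of `[n]`, so that every morphism of `ΔG` acts on vertices by a map of sets, and the
oriented chains of the standard simplices are functorial for maps of sets. Linear combinations of monotone
maps act faithfully on oriented chains (`SimplexCategory.eq_zero_of_pullback_eq_zero`), and every
map of sets acts like such a linear combination (`SimplexCategory.exists_represents`): a map of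
sets is a monotone map after a permutation, and the exchange of the vertices `i` and `i + 1`
acts like `α + β - id`, where `α` and `β` collapse the edge between them to one of its ends. Hence
`p` sends a morphism of `ΔG` to the linear combination with the same action. Instead of chains, the
proof uses the dual notion of alternating functions of tuples of vertices.

*The model structure on simplicial vector spaces.* By the Dold-Kan correspondence it is enough to
treat nonnegatively graded chain complexes. Over a field an acyclic complex is contractible, and
therefore both injective and projective. Trivial cofibrations are thus split with contractible
cokernel and have the lifting property against morphisms which are surjective in positive degrees
(`ChainComplex.hasLiftingProperty_of_mono_of_quasiIso`). A morphism `X ⟶ Y` factors through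
`X ⊞ Z`, where `Z` is contractible and maps onto `Y` in positive degrees, and through `Y ⊞ E`, where
`E` is the cone of the identity of `X`.

*The transfer.* As `p` is surjective, `Res` is fully faithful and exact, the unit of the adjunction
is an isomorphism, and the counit is a monomorphism: `CoInd Y` is the largest submodule of `Y` on
which `ΔG` acts through `p`. If `CoInd X ⟶ A` is a cofibration, i.e. a monomorphism, then the
pushout of `Res A` along `Res (CoInd X) ⟶ X` has coinduction `A`
(`CategoryTheory.Adjunction.isIso_homEquiv_of_isPushout`). Hence a factorization of `CoInd f` lifts
to one of `f` in which the first morphism is a pushout of the restriction of a cofibration. This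
gives the transferred model structure, and the adjunction is a Quillen equivalence because weak
equivalences are detected by `CoInd` and the unit is an isomorphism.
-/

noncomputable section

/-! ### Linear combinations of monotone maps acting on alternating functions -/

namespace SimplexCategory

variable {k : Type u} [CommRing k] {l m n : SimplexCategory}

/-- A function of `r`-tuples is alternating if it vanishes on tuples with repetitions and changes
its sign when two entries are exchanged. -/
structure IsAlternating {r : ℕ} {V : Type*} (ω : (Fin r → V) → k) : Prop where
  eq_zero (x : Fin r → V) (hx : ¬ x.Injective) : ω x = 0
  swap (x : Fin r → V) (i j : Fin r) (hij : i ≠ j) : ω (x ∘ Equiv.swap i j) = - ω x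

lemma IsAlternating.comp_map {r : ℕ} {V W : Type*} {ω : (Fin r → W) → k} (hω : IsAlternating ω)
    (f : V → W) : IsAlternating fun x : Fin r → V => ω (f ∘ x) where
  eq_zero _ hx := hω.eq_zero _ fun h => hx h.of_comp
  swap x i j hij := hω.swap (f ∘ x) i j hij

/-- The pullback of a function of tuples of vertices of `[n]` along a linear combination of monotone
maps `[m] ⟶ [n]`, evaluated at a tuple of vertices of `[m]`; it is linear in the combination. -/
def pullback {r : ℕ} (ω : (Fin r → Fin (n.len + 1)) → k) (x : Fin r → Fin (m.len + 1)) :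
    (Free.of k m ⟶ Free.of k n) →ₗ[k] k :=
  Finsupp.linearCombination k fun φ : m ⟶ n => ω (φ.toOrderHom ∘ x)

@[simp]
lemma pullback_freeHom {r : ℕ} (ω : (Fin r → Fin (n.len + 1)) → k) (x : Fin r → Fin (m.len + 1))
    (φ : m ⟶ n) : pullback ω x (freeHom k φ) = ω (φ.toOrderHom ∘ x) :=
  (Finsupp.linearCombination_single k 1 φ).trans (one_smul _ _)

lemma pullback_comp {r : ℕ} (ω : (Fin r → Fin (n.len + 1)) → k) (x : Fin r → Fin (l.len + 1))
    (a : Free.of k l ⟶ Free.of k m) (b : Free.of k m ⟶ Free.of k n) :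
    pullback ω x (a ≫ b) = pullback (fun y => pullback ω y b) x a := by
  induction a using free_induction with
  | zero => rw [Limits.zero_comp, map_zero, map_zero]
  | add a₁ a₂ h₁ h₂ => rw [Preadditive.add_comp, map_add, map_add, h₁, h₂]
  | smul r a h => rw [Linear.smul_comp, map_smul, map_smul, h]
  | of φ =>
    rw [pullback_freeHom]
    induction b using free_induction with
    | zero => rw [Limits.comp_zero, map_zero, map_zero]
    | add b₁ b₂ h₁ h₂ => rw [Preadditive.comp_add, map_add, map_add, h₁, h₂]
    | smul r b h => rw [Linear.comp_smul, map_smul, map_smul, h]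
    | of ψ =>
      rw [← freeHom_comp, pullback_freeHom, pullback_freeHom]
      rfl

/-- The alternating function which is dual to the tuple `t`. -/
def dualTuple (k : Type u) [CommRing k] {r : ℕ} {V : Type*} [DecidableEq V] (t : Fin r → V)
    (x : Fin r → V) : k :=
  (Matrix.of fun i j => if x i = t j then (1 : k) else 0).det

lemma isAlternating_dualTuple {r : ℕ} {V : Type*} [DecidableEq V] (t : Fin r → V) :
    IsAlternating (dualTuple k t) where
  eq_zero x hx := by
    simp only [Function.Injective, not_forall] at hx
    obtain ⟨i, j, hij, h⟩ := hx
    exact Matrix.det_zero_of_row_eq h (by ext l; simp [hij])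
  swap x i j hij := by
    refine (Matrix.det_permute (Equiv.swap i j)
      (Matrix.of fun i j => if x i = t j then (1 : k) else 0)).trans ?_
    simp [Equiv.Perm.sign_swap hij, dualTuple]

lemma dualTuple_self {r : ℕ} {V : Type*} [DecidableEq V] {t : Fin r → V} (ht : t.Injective) :
    dualTuple k t t = 1 := by
  refine Eq.trans (congrArg Matrix.det ?_) Matrix.det_one
  ext i j
  simp [Matrix.one_apply, ht.eq_iff]

lemma dualTuple_of_ne {r : ℕ} {V : Type*} [LinearOrder V] {t x : Fin r → V}
    (ht : StrictMono t) (hx : Monotone x) (h : x ≠ t) : dualTuple k t x = 0 := by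
  by_cases hx' : x.Injective
  · by_cases hj : ∀ i, ∃ j, x i = t j
    · refine (h ?_).elim
      choose j hj using hj
      have hj' : j.Injective := fun a b hab => hx' (by rw [hj, hj, hab])
      have e : Set.range x = Set.range t := by
        rw [show x = t ∘ j from funext hj, (Finite.surjective_of_injective hj').range_comp]
      exact ((hx.strictMono_of_injective hx').range_inj ht).1 e
    · push Not at hj
      obtain ⟨i, hi⟩ := hj
      exact Matrix.det_eq_zero_of_row_eq_zero i fun j => by simp [hi j]
  · exact (isAlternating_dualTuple t).eq_zero x hx'

/-- A linear combination of monotone maps is determined by its action on alternating functions.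
A map `φ₀` of the support whose sum of values is maximal is the only one in the support which
agrees with `φ₀` on the least elements of the fibres of `φ₀`. -/
lemma eq_zero_of_pullback_eq_zero (a : Free.of k m ⟶ Free.of k n)
    (ha : ∀ (r : ℕ) (ω : (Fin r → Fin (n.len + 1)) → k) (_ : IsAlternating ω)
      (x : Fin r → Fin (m.len + 1)), pullback ω x a = 0) : a = 0 := by
  let c : (m ⟶ n) →₀ k := a
  change c = 0
  by_contra hc
  obtain ⟨φ₀, h₀, hmax⟩ := c.support.exists_max_image
    (fun φ => ∑ x, (φ.toOrderHom x : ℕ)) (Finsupp.support_nonempty_iff.2 hc)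
  let S : Finset (Fin (m.len + 1)) :=
    Finset.univ.filter fun x => ∀ y, y < x → φ₀.toOrderHom y < φ₀.toOrderHom x
  let s := S.orderEmbOfFin rfl
  have hs (x) : ∃ i, s i ≤ x ∧ φ₀.toOrderHom (s i) = φ₀.toOrderHom x := by
    have hne : (Finset.univ.filter fun y => φ₀.toOrderHom y = φ₀.toOrderHom x).Nonempty :=
      ⟨x, by simp⟩
    let y := Finset.min' _ hne
    have hy : φ₀.toOrderHom y = φ₀.toOrderHom x := (Finset.mem_filter.1 (Finset.min'_mem _ hne)).2
    have hyS : y ∈ S := by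
      refine Finset.mem_filter.2 ⟨Finset.mem_univ _, fun z hz => ?_⟩
      refine lt_of_le_of_ne (φ₀.toOrderHom.monotone hz.le) fun h => ?_
      exact (Finset.min'_le _ z (by simp [h, hy])).not_gt hz
    obtain ⟨i, hi⟩ : y ∈ Set.range s := by rwa [Finset.range_orderEmbOfFin]
    exact ⟨i, by rw [hi]; exact Finset.min'_le _ _ (by simp), by rw [hi, hy]⟩
  let t : Fin S.card → Fin (n.len + 1) := φ₀.toOrderHom ∘ s
  have ht : StrictMono t := fun i j hij =>
    (Finset.mem_filter.1 (S.orderEmbOfFin_mem rfl j)).2 _ (s.strictMono hij)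
  have huniq (φ) (hφ : φ ∈ c.support) (h : φ.toOrderHom ∘ s = t) : φ = φ₀ := by
    have hle (x) : φ₀.toOrderHom x ≤ φ.toOrderHom x := by
      obtain ⟨i, hi, hi'⟩ := hs x
      rw [← hi']
      exact (congrFun h i).ge.trans (φ.toOrderHom.monotone hi)
    have hle' (x) (_ : x ∈ Finset.univ) : (φ₀.toOrderHom x : ℕ) ≤ φ.toOrderHom x := hle x
    have hval := (Finset.sum_eq_sum_iff_of_le hle').1
      ((Finset.sum_le_sum hle').antisymm (hmax φ hφ))
    ext x
    exact (hval x (Finset.mem_univ _)).symm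
  have h := ha _ (dualTuple k t) (isAlternating_dualTuple t) s
  have e : pullback (dualTuple k t) s a = ∑ φ ∈ c.support, c φ * dualTuple k t (φ.toOrderHom ∘ s) :=
    rfl
  rw [e, Finset.sum_eq_single_of_mem φ₀ h₀ fun φ hφ hne => ?_] at h
  · rw [show φ₀.toOrderHom ∘ s = t from rfl, dualTuple_self ht.injective, mul_one] at h
    exact Finsupp.mem_support_iff.1 h₀ h
  · rw [dualTuple_of_ne ht (φ.toOrderHom.monotone.comp s.monotone) fun h => hne (huniq φ hφ h),
      mul_zero]

/-- A linear combination of monotone maps represents a map of sets if both have the same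
action on alternating functions, i.e. on the oriented chains of the simplices. -/
def Represents (a : Free.of k m ⟶ Free.of k n) (f : Fin (m.len + 1) → Fin (n.len + 1)) : Prop :=
  ∀ (r : ℕ) (ω : (Fin r → Fin (n.len + 1)) → k) (_ : IsAlternating ω)
    (x : Fin r → Fin (m.len + 1)), pullback ω x a = ω (f ∘ x)

lemma represents_freeHom (φ : m ⟶ n) : Represents (freeHom k φ) φ.toOrderHom :=
  fun _ ω _ x => pullback_freeHom ω x φ

lemma Represents.comp {a : Free.of k l ⟶ Free.of k m} {b : Free.of k m ⟶ Free.of k n}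
    {f : Fin (l.len + 1) → Fin (m.len + 1)} {g : Fin (m.len + 1) → Fin (n.len + 1)}
    (ha : Represents a f) (hb : Represents b g) : Represents (a ≫ b) (g ∘ f) := fun r ω hω x => by
  rw [pullback_comp]
  simp_rw [hb r ω hω]
  exact ha r _ (hω.comp_map g) x

lemma Represents.unique {a b : Free.of k m ⟶ Free.of k n}
    {f : Fin (m.len + 1) → Fin (n.len + 1)} (ha : Represents a f) (hb : Represents b f) : a = b :=
  sub_eq_zero.1 (eq_zero_of_pullback_eq_zero _ fun r ω hω x => by
    rw [map_sub, ha r ω hω, hb r ω hω, sub_self])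

/-- The exchange of two neighbouring vertices `i` and `i + 1` is represented by `α + β - id`, where
`α` and `β` collapse the edge between these vertices to `i` and to `i + 1`, respectively. -/
lemma exists_represents_swap (k : Type u) [CommRing k] (m : SimplexCategory) (i : Fin m.len) :
    ∃ a : Free.of k m ⟶ Free.of k m, Represents a (Equiv.swap i.castSucc i.succ) := by
  let α : m ⟶ m := Hom.mk ⟨fun x => if x = i.succ then i.castSucc else x, fun x y h => by
    simp only [Fin.le_def, Fin.ext_iff, apply_ite Fin.val, Fin.val_succ, Fin.val_castSucc] at h ⊢
    split_ifs <;> omega⟩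
  let β : m ⟶ m := Hom.mk ⟨fun x => if x = i.castSucc then i.succ else x, fun x y h => by
    simp only [Fin.le_def, Fin.ext_iff, apply_ite Fin.val, Fin.val_succ, Fin.val_castSucc] at h ⊢
    split_ifs <;> omega⟩
  have hα (x) : α.toOrderHom x = if x = i.succ then i.castSucc else x := rfl
  have hβ (x) : β.toOrderHom x = if x = i.castSucc then i.succ else x := rfl
  have hi : i.castSucc ≠ i.succ := i.castSucc_lt_succ.ne
  refine ⟨freeHom k α + freeHom k β - freeHom k (𝟙 m), fun r ω hω x => ?_⟩
  rw [map_sub, map_add, pullback_freeHom, pullback_freeHom, pullback_freeHom]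
  change _ + _ - ω x = _
  by_cases hp : ∃ p, x p = i.castSucc
  · by_cases hq : ∃ q, x q = i.succ
    · obtain ⟨p, hp⟩ := hp
      obtain ⟨q, hq⟩ := hq
      have hpq : p ≠ q := fun h => hi (by rw [← hp, ← hq, h])
      rw [hω.eq_zero (α.toOrderHom ∘ x) fun h => hpq (h (by simp [hα, hp, hq, hi])),
        hω.eq_zero (β.toOrderHom ∘ x) fun h => hpq (h (by simp [hβ, hp, hq])), add_zero, zero_sub]
      by_cases hx : x.Injective
      · rw [← hω.swap x p q hpq, ← hp, ← hq]
        exact congrArg ω (funext fun j => hx.map_swap p q j)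
      · rw [hω.eq_zero x hx, hω.eq_zero _ fun h => hx h.of_comp, neg_zero]
    · push Not at hq
      rw [show α.toOrderHom ∘ x = x from funext fun j => if_neg (hq j), add_sub_cancel_left]
      refine congrArg ω (funext fun j => ?_)
      simp only [Function.comp_apply, hβ, Equiv.swap_apply_def, if_neg (hq j)]
  · push Not at hp
    rw [show β.toOrderHom ∘ x = x from funext fun j => if_neg (hp j), add_sub_cancel_right]
    refine congrArg ω (funext fun j => ?_)
    simp only [Function.comp_apply, hα, Equiv.swap_apply_def, if_neg (hp j)]

lemma exists_represents_perm (k : Type u) [CommRing k] (m : SimplexCategory)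
    (σ : Equiv.Perm (Fin (m.len + 1))) : ∃ a : Free.of k m ⟶ Free.of k m, Represents a σ := by
  have hσ : σ ∈ Submonoid.closure
      (Set.range fun i : Fin m.len => Equiv.swap i.castSucc i.succ) := by
    rw [Equiv.Perm.mclosure_swap_castSucc_succ]
    exact Submonoid.mem_top σ
  induction hσ using Submonoid.closure_induction with
  | mem σ h =>
    obtain ⟨i, rfl⟩ := h
    exact exists_represents_swap k m i
  | one => exact ⟨_, represents_freeHom (𝟙 m)⟩
  | mul σ τ _ _ hσ hτ =>
    obtain ⟨a, ha⟩ := hσ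
    obtain ⟨b, hb⟩ := hτ
    exact ⟨b ≫ a, hb.comp ha⟩

/-- Every map of sets is the composition of a permutation and a monotone map. -/
lemma exists_represents (k : Type u) [CommRing k] (f : Fin (m.len + 1) → Fin (n.len + 1)) :
    ∃ a : Free.of k m ⟶ Free.of k n, Represents a f := by
  obtain ⟨a, ha⟩ := exists_represents_perm k m (Tuple.sort f)⁻¹
  have hb := represents_freeHom (k := k) (m := m) (n := n)
    (Hom.mk ⟨f ∘ Tuple.sort f, Tuple.monotone_sort f⟩)
  have e : (f ∘ Tuple.sort f) ∘ ⇑(Tuple.sort f)⁻¹ = f :=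
    funext fun x => congrArg f ((Tuple.sort f).apply_symm_apply x)
  have h := ha.comp hb
  exact ⟨_, e ▸ h⟩

end SimplexCategory

/-! ### The epimorphism from the categorical algebra of `ΔG` to that of `Δ` -/

namespace CrossedSimplicialGroup

open SimplexCategory
open scoped Simplicial

variable (D : CrossedSimplicialGroup.{v})

/-- A vertex of `[n]` as a morphism `[0] ⟶ [n]` in `ΔG`. -/
def vertex (c : D.Cat) (x : Fin (c.as.len + 1)) : D.of ⦋0⦌ ⟶ c :=
  D.inclusion.map (const ⦋0⦌ c.as x)

/-- The morphisms `[0] ⟶ [n]` in `ΔG` are the vertices of `[n]`, up to automorphisms of `[0]`. -/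
lemma existsUnique_vertex {c : D.Cat} (f : D.of ⦋0⦌ ⟶ c) :
    ∃! y : Fin (c.as.len + 1), ∃ e : Aut (D.of ⦋0⦌), f = e.hom ≫ D.vertex c y := by
  let _ := D.category
  let _ := D.group
  obtain ⟨⟨φ, g⟩, h, huniq⟩ := D.factorization f
  refine ⟨φ.toOrderHom 0, ⟨(D.aut ⦋0⦌).symm (MulOpposite.op g), ?_⟩, ?_⟩
  · have hφ : D.vertex c (φ.toOrderHom 0) = D.inclusion.map φ :=
      congrArg D.inclusion.map (eq_const_of_zero φ).symm
    rw [hφ]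
    exact h
  · rintro y ⟨e, he⟩
    have he' : (D.aut ⦋0⦌).symm (MulOpposite.op ((D.aut ⦋0⦌) e).unop) = e :=
      (D.aut ⦋0⦌).symm_apply_apply e
    have := huniq (const ⦋0⦌ c.as y, ((D.aut ⦋0⦌) e).unop)
      (he.trans (congrArg (fun e : Aut (D.of ⦋0⦌) => e.hom ≫ D.vertex c y) he'.symm))
    exact congrArg (fun z => z.1.toOrderHom 0) this

/-- The action of a morphism of `ΔG` on vertices. -/
def vertexMap {c d : D.Cat} (f : c ⟶ d) (x : Fin (c.as.len + 1)) : Fin (d.as.len + 1) :=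
  (D.existsUnique_vertex (D.vertex c x ≫ f)).choose

variable {D}

lemma vertexMap_spec {c d : D.Cat} (f : c ⟶ d) (x : Fin (c.as.len + 1)) :
    ∃ e : Aut (D.of ⦋0⦌), D.vertex c x ≫ f = e.hom ≫ D.vertex d (D.vertexMap f x) :=
  (D.existsUnique_vertex (D.vertex c x ≫ f)).choose_spec.1

lemma vertexMap_eq {c d : D.Cat} (f : c ⟶ d) (x : Fin (c.as.len + 1)) (y : Fin (d.as.len + 1))
    (e : Aut (D.of ⦋0⦌)) (h : D.vertex c x ≫ f = e.hom ≫ D.vertex d y) : D.vertexMap f x = y :=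
  ((D.existsUnique_vertex (D.vertex c x ≫ f)).choose_spec.2 y ⟨e, h⟩).symm

lemma vertexMap_inclusion {m n : SimplexCategory} (φ : m ⟶ n) :
    D.vertexMap (D.inclusion.map φ) = φ.toOrderHom := by
  funext x
  refine vertexMap_eq _ _ _ (Iso.refl _) ?_
  refine (D.inclusion.map_comp _ _).symm.trans ((congrArg D.inclusion.map ?_).trans
    (Category.id_comp _).symm)
  exact const_comp _ _ _

lemma vertexMap_comp {c d e : D.Cat} (f : c ⟶ d) (g : d ⟶ e) :
    D.vertexMap (f ≫ g) = D.vertexMap g ∘ D.vertexMap f := by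
  funext x
  obtain ⟨α, hα⟩ := vertexMap_spec f x
  obtain ⟨β, hβ⟩ := vertexMap_spec g (D.vertexMap f x)
  refine vertexMap_eq _ _ _ (α ≪≫ β) ?_
  rw [← Category.assoc, hα, Category.assoc, hβ]
  exact (Category.assoc _ _ _).symm

variable (D) in
/-- The algebra epimorphism `p` sends a morphism of `ΔG` to the linear combination of morphisms
of `Δ` with the same action on the oriented chains of the simplices. -/
lemma nonempty_projection (k : Type u) [Field k] : Nonempty (D.Projection k) := by
  choose a ha using fun (c d : D.Cat) (f : c ⟶ d) =>
    exists_represents (m := c.as) (n := d.as) k (D.vertexMap f)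
  have a_comp {c d e : D.Cat} (f : c ⟶ d) (g : d ⟶ e) :
      a c e (f ≫ g) = a c d f ≫ a d e g :=
    (ha c e (f ≫ g)).unique (vertexMap_comp f g ▸ (ha c d f).comp (ha d e g))
  have a_incl {m n : SimplexCategory} (φ : m ⟶ n) :
      a (D.of m) (D.of n) (D.inclusion.map φ) = freeHom k φ :=
    (ha _ _ (D.inclusion.map φ)).unique ((vertexMap_inclusion (D := D) φ).symm ▸
      represents_freeHom φ)
  let P {c d : D.Cat} : (Free.of k c ⟶ Free.of k d) →ₗ[k] (Free.of k c.as ⟶ Free.of k d.as) :=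
    Finsupp.linearCombination k (a c d)
  have P_freeHom {c d : D.Cat} (f : c ⟶ d) : P (freeHom k f) = a c d f :=
    (Finsupp.linearCombination_single k 1 f).trans (one_smul _ _)
  refine ⟨⟨P, fun c => ?_, fun {c d e} x y => ?_, fun φ => ?_⟩⟩
  · refine (P_freeHom (𝟙 c)).trans ?_
    exact (congrArg (a c c) (D.inclusion.map_id c.as).symm).trans (a_incl (𝟙 c.as))
  · induction x using free_induction with
    | zero => rw [Limits.zero_comp, map_zero, map_zero, Limits.zero_comp]
    | add x₁ x₂ h₁ h₂ => rw [Preadditive.add_comp, map_add, map_add, Preadditive.add_comp, h₁, h₂]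
    | smul r x h => rw [Linear.smul_comp, map_smul, map_smul, Linear.smul_comp, h]
    | of f =>
      induction y using free_induction with
      | zero => rw [Limits.comp_zero, map_zero, map_zero, Limits.comp_zero]
      | add y₁ y₂ h₁ h₂ => rw [Preadditive.comp_add, map_add, map_add, Preadditive.comp_add, h₁, h₂]
      | smul r y h => rw [Linear.comp_smul, map_smul, map_smul, Linear.comp_smul, h]
      | of g => rw [← freeHom_comp, P_freeHom, P_freeHom, P_freeHom, a_comp]
  · exact (P_freeHom _).trans (a_incl φ)

end CrossedSimplicialGroup

/-! ### Chain complexes with projective objects -/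

namespace ChainComplex

open Limits HomologicalComplex
open scoped ZeroObject

variable {A : Type*} [Category* A] [Abelian A]

/-- The identity of a contractible complex is the map `d h + h d` attached to a contraction `h`. -/
lemma nullHomotopicMap_hom_eq {K : ChainComplex A ℕ} (h : Homotopy (𝟙 K) 0) :
    Homotopy.nullHomotopicMap h.hom = 𝟙 K := by
  ext n
  exact ((h.comm n).trans (add_zero _)).symm

/-- A contractible complex admits lifts along every morphism which is an epimorphism in positive
degrees: if `l` lifts `h ≫ g` degreewise, for a contraction `h`, then `d l + l d` lifts `g`. -/
lemma exists_lift_of_contraction [∀ X : A, Projective X] {K X Y : ChainComplex A ℕ}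
    (h : Homotopy (𝟙 K) 0) (f : X ⟶ Y) (hf : ∀ n, Epi (f.f (n + 1))) (g : K ⟶ Y) :
    ∃ l : K ⟶ X, l ≫ f = g := by
  have hl (i j : ℕ) : ∃ l : K.X i ⟶ X.X j, l ≫ f.f j = h.hom i j ≫ g.f j := by
    by_cases hij : (ComplexShape.down ℕ).Rel j i
    · obtain rfl : i + 1 = j := hij
      exact ⟨Projective.factorThru _ (f.f (i + 1)), Projective.factorThru_comp _ _⟩
    · exact ⟨0, by rw [h.zero i j hij, zero_comp, zero_comp]⟩
  choose l hl using hl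
  refine ⟨Homotopy.nullHomotopicMap l, ?_⟩
  rw [Homotopy.nullHomotopicMap_comp]
  simp_rw [hl]
  rw [← Homotopy.nullHomotopicMap_comp, nullHomotopicMap_hom_eq, Category.id_comp]

lemma projective_of_contraction [∀ X : A, Projective X] {K : ChainComplex A ℕ}
    (h : Homotopy (𝟙 K) 0) : Projective K :=
  ⟨fun g f _ => exists_lift_of_contraction h f (fun _ => inferInstance) g⟩

lemma _root_.CategoryTheory.Limits.shortExact_cokernel {C : Type*} [Category* C] [Abelian C]
    {X Y : C} (f : X ⟶ Y) [Mono f] :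
    (ShortComplex.mk f (cokernel.π f) (cokernel.condition f)).ShortExact where
  exact := ShortComplex.exact_of_g_is_cokernel _ (cokernelIsCokernel f)
  mono_f := inferInstanceAs (Mono f)
  epi_g := inferInstanceAs (Epi (cokernel.π f))

lemma _root_.CategoryTheory.Injective.of_forall_projective [∀ X : A, Projective X] (X : A) :
    Injective X := by
  refine ⟨fun {Y Z} g f _ => ?_⟩
  have hS := shortExact_cokernel f
  refine ⟨hS.splittingOfProjective.r ≫ g, ?_⟩
  rw [← Category.assoc]
  exact (congrArg (· ≫ g) hS.splittingOfProjective.f_r).trans (Category.id_comp g)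

lemma injective_of_contraction [∀ X : A, Projective X] {K : ChainComplex A ℕ}
    (h : Homotopy (𝟙 K) 0) : Injective K := by
  refine ⟨fun {X Y} g f _ => ?_⟩
  have (X : A) : Injective X := Injective.of_forall_projective X
  refine ⟨Homotopy.nullHomotopicMap fun i j => Injective.factorThru (g.f i) (f.f i) ≫ h.hom i j, ?_⟩
  rw [Homotopy.comp_nullHomotopicMap]
  simp_rw [← Category.assoc, Injective.comp_factorThru]
  rw [← Homotopy.comp_nullHomotopicMap, nullHomotopicMap_hom_eq, Category.comp_id]

/-- An acyclic complex of projectives is a projective resolution of zero, so that its identity is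
homotopic to zero. -/
lemma nonempty_contraction_of_acyclic [∀ X : A, Projective X] {K : ChainComplex A ℕ}
    (hK : K.Acyclic) : Nonempty (Homotopy (𝟙 K) 0) := by
  have hZ : IsZero ((single₀ A).obj 0) := (single₀ A).map_isZero (isZero_zero A)
  let P : ProjectiveResolution (0 : A) :=
    { complex := K
      π := 0
      quasiIso := ⟨fun n =>
        (quasiIsoAt_iff_exactAt _ _ (hK n)).2 (acyclic_of_isZero _ hZ n)⟩ }
  exact ⟨ProjectiveResolution.liftHomotopy (𝟙 0) (P := P) (Q := P) (𝟙 K) 0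
    (hZ.eq_of_tgt _ _) (hZ.eq_of_tgt _ _)⟩

/-- A monomorphism which is a quasi-isomorphism is split, with contractible cokernel. -/
lemma hasLiftingProperty_of_mono_of_quasiIso [∀ X : A, Projective X] {K L X Y : ChainComplex A ℕ}
    (i : K ⟶ L) [Mono i] [QuasiIso i] (f : X ⟶ Y) (hf : ∀ n, Epi (f.f (n + 1))) :
    HasLiftingProperty i f where
  sq_hasLift {u w} sq := by
    have hS := shortExact_cokernel i
    obtain ⟨h⟩ := nonempty_contraction_of_acyclic (hS.acyclic_X₃ (inferInstanceAs (QuasiIso i)))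
    have : Projective (cokernel i) := projective_of_contraction h
    let s := hS.splittingOfProjective
    obtain ⟨l, hl⟩ := exists_lift_of_contraction h f hf (s.s ≫ w)
    have h₁ : i ≫ s.r = 𝟙 K := s.f_r
    have h₂ : s.r ≫ i + cokernel.π i ≫ s.s = 𝟙 L := s.id
    refine ⟨⟨⟨s.r ≫ u + cokernel.π i ≫ l, ?_, ?_⟩⟩⟩
    · rw [Preadditive.comp_add, reassoc_of% h₁, cokernel.condition_assoc, zero_comp, add_zero]
    · rw [Preadditive.add_comp, Category.assoc, Category.assoc, hl, sq.w, ← Category.assoc,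
        ← Category.assoc, ← Preadditive.add_comp, h₂, Category.id_comp]

/-- The cone of the identity. -/
abbrev coneId (K : ChainComplex A ℕ) : ChainComplex A ℕ := homotopyCofiber (𝟙 K)

/-- The contraction of the cone of the identity which maps the copy of `K` in the cone
identically to the shifted copy. -/
def coneIdContraction (K : ChainComplex A ℕ) : Homotopy (𝟙 (coneId K)) 0 where
  hom i j := if h : (ComplexShape.down ℕ).Rel j i then
    homotopyCofiber.sndX (𝟙 K) i ≫ homotopyCofiber.inlX (𝟙 K) i j h else 0
  zero i j h := dif_neg h
  comm n := by
    have h₁ : (ComplexShape.down ℕ).Rel (n + 1) n := rfl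
    rw [prevD_eq _ h₁, dif_pos h₁]
    cases n with
    | zero =>
      have h₀ : ¬ (ComplexShape.down ℕ).Rel 0 ((ComplexShape.down ℕ).next 0) := by simp
      rw [dNext_eq_zero _ _ h₀]
      refine homotopyCofiber.ext_from_X' (𝟙 K) _ h₀ ?_
      simp [homotopyCofiber.inlX_d' (𝟙 K) 1 0 rfl h₀]
    | succ n =>
      have h₂ : (ComplexShape.down ℕ).Rel (n + 1) n := rfl
      rw [dNext_eq _ h₂, dif_pos h₂]
      refine homotopyCofiber.ext_from_X (𝟙 K) _ _ h₂ ?_ ?_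
      · cases n with
        | zero =>
          have h₀ : ¬ (ComplexShape.down ℕ).Rel 0 ((ComplexShape.down ℕ).next 0) := by simp
          simp [homotopyCofiber.inlX_d'_assoc (𝟙 K) 1 0 rfl h₀]
        | succ n =>
          have h₃ := homotopyCofiber.inlX_sndX_assoc (𝟙 K) n (n + 1) rfl
            (homotopyCofiber.inlX (𝟙 K) (n + 1) (n + 2) rfl)
          simp only [zero_comp] at h₃
          have h₄ := congrArg (K.d (n + 1) n ≫ ·) h₃
          simp only [comp_zero] at h₄
          simpa [homotopyCofiber.inlX_d_assoc (𝟙 K) (n + 2) (n + 1) n rfl rfl] using h₄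
      · simp [homotopyCofiber.inlX_d (𝟙 K) (n + 2) (n + 1) n rfl rfl]

/-- A summand which is contractible can be removed up to homotopy. -/
def homotopyEquivBiprod (K Z : ChainComplex A ℕ) (h : Homotopy (𝟙 Z) 0) :
    HomotopyEquiv K (K ⊞ Z) where
  hom := biprod.inl
  inv := biprod.fst
  homotopyHomInvId := Homotopy.ofEq (by simp)
  homotopyInvHomId :=
    have e : Homotopy (biprod.snd ≫ 𝟙 Z ≫ biprod.inr) (0 : K ⊞ Z ⟶ K ⊞ Z) :=
      ((h.compRight biprod.inr).compLeft biprod.snd).trans (Homotopy.ofEq (by simp))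
    have e' : Homotopy (biprod.fst ≫ biprod.inl + 0 : K ⊞ Z ⟶ K ⊞ Z)
        (biprod.fst ≫ biprod.inl + biprod.snd ≫ 𝟙 Z ≫ biprod.inr) := (Homotopy.refl _).add e.symm
    ((Homotopy.ofEq (by simp)).trans e').trans
      (Homotopy.ofEq (by rw [Category.id_comp, biprod.total]))

instance (K L : ChainComplex A ℕ) : QuasiIso (biprod.inl : K ⟶ K ⊞ coneId L) :=
  (homotopyEquivBiprod K _ (coneIdContraction L)).quasiIso_hom

instance (K L : ChainComplex A ℕ) : QuasiIso (biprod.fst : K ⊞ coneId L ⟶ K) :=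
  (homotopyEquivBiprod K _ (coneIdContraction L)).quasiIso_inv

/-- The complex with zero differentials given by the components of positive degree of `Y`. -/
def shiftDown (Y : ChainComplex A ℕ) : ChainComplex A ℕ where
  X n := Y.X (n + 1)
  d _ _ := 0

/-- The components `Yₙ₊₁ ⟶ Yₙ₊₁` of a map of degree one from `shiftDown Y` to `Y`. -/
def shiftDownHom (Y : ChainComplex A ℕ) (i j : ℕ) (h : (ComplexShape.down ℕ).Rel j i) :
    Y.shiftDown.X i ⟶ Y.X j :=
  eqToHom (congrArg Y.X h)

/-- Every complex `Y` receives a map from a contractible complex which is an epimorphism in positive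
degrees. -/
def coneShiftDownMap (Y : ChainComplex A ℕ) : coneId Y.shiftDown ⟶ Y :=
  homotopyCofiber.desc _ (Homotopy.nullHomotopicMap' Y.shiftDownHom)
    ((Homotopy.ofEq (Category.id_comp _)).trans (Homotopy.nullHomotopy' Y.shiftDownHom))

instance (Y : ChainComplex A ℕ) (n : ℕ) : Epi (Y.coneShiftDownMap.f (n + 1)) := by
  have h : homotopyCofiber.inlX (𝟙 Y.shiftDown) n (n + 1) rfl ≫ Y.coneShiftDownMap.f (n + 1) =
      𝟙 (Y.X (n + 1)) := by
    refine (homotopyCofiber.inlX_desc_f _ _ _ _ _ _).trans ?_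
    simp [Homotopy.nullHomotopy', Homotopy.nullHomotopy, Homotopy.ofEq, Homotopy.trans,
      shiftDownHom]
    rfl
  have : Epi (homotopyCofiber.inlX (𝟙 Y.shiftDown) n (n + 1) rfl ≫
      Y.coneShiftDownMap.f (n + 1)) := by
    rw [h]; exact inferInstanceAs (Epi (𝟙 (Y.X (n + 1))))
  exact epi_of_epi (homotopyCofiber.inlX (𝟙 Y.shiftDown) n (n + 1) rfl) _

end ChainComplex

/-! ### The model structure on chain complexes -/

namespace ChainComplex

open Limits HomologicalComplex MorphismProperty

variable (A : Type*) [Category* A] [Abelian A]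

/-- The class of monomorphisms which are quasi-isomorphisms. -/
abbrev monoQuasiIso : MorphismProperty (ChainComplex A ℕ) :=
  monomorphisms _ ⊓ quasiIso A _

variable {A} in
lemma exists_factorization_monoQuasiIso [∀ X : A, Projective X] {X Y : ChainComplex A ℕ}
    (f : X ⟶ Y) : Nonempty ((monoQuasiIso A).MapFactorizationData (monoQuasiIso A).rlp f) :=
  ⟨{Z := X ⊞ coneId Y.shiftDown
    i := biprod.inl
    p := biprod.desc f Y.coneShiftDownMap
    hi := ⟨inferInstanceAs (Mono biprod.inl), inferInstanceAs (QuasiIso biprod.inl)⟩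
    hp := fun K L i hi => by
      have := hi.1
      have := hi.2
      simp only [monomorphisms.iff, mem_quasiIso_iff] at *
      refine hasLiftingProperty_of_mono_of_quasiIso i _ fun n => ?_
      have : Epi ((biprod.inr : _ ⟶ X ⊞ coneId Y.shiftDown).f (n + 1) ≫
          (biprod.desc f Y.coneShiftDownMap).f (n + 1)) := by
        rw [← comp_f, biprod.inr_desc]
        infer_instance
      exact epi_of_epi ((biprod.inr : _ ⟶ X ⊞ coneId Y.shiftDown).f (n + 1)) _ }⟩

variable {A} in
lemma exists_factorization_monomorphisms [∀ X : A, Projective X] {X Y : ChainComplex A ℕ}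
    (f : X ⟶ Y) :
    Nonempty ((monomorphisms _).MapFactorizationData ((monomorphisms _).rlp ⊓ quasiIso A _) f) :=
  ⟨{Z := Y ⊞ coneId X
    i := biprod.lift f (homotopyCofiber.inr (𝟙 X))
    p := biprod.fst
    hi := by
      have : Mono (homotopyCofiber.inr (𝟙 X)) := by
        have (n : ℕ) : Mono ((homotopyCofiber.inr (𝟙 X)).f n) :=
          mono_of_mono_fac (homotopyCofiber.inrX_sndX (𝟙 X) n)
        exact mono_of_mono_f _ this
      exact mono_of_mono_fac (biprod.lift_snd f (homotopyCofiber.inr (𝟙 X)))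
    hp := by
      refine ⟨fun K L i hi => ?_, inferInstanceAs (QuasiIso biprod.fst)⟩
      have : Mono i := hi
      have : Injective (coneId X) := injective_of_contraction (coneIdContraction X)
      refine ⟨fun {u w} sq => ⟨⟨⟨biprod.lift w (Injective.factorThru (u ≫ biprod.snd) i), ?_, ?_⟩⟩⟩⟩
      · refine biprod.hom_ext _ _ ?_ ?_
        · simp [sq.w]
        · simp
      · simp }⟩

/-- A fibration which is a quasi-isomorphism is a retract of a projection `Y ⊞ E ⟶ Y` with `E`
injective and contractible. -/
lemma rlp_inf_quasiIso_le [∀ X : A, Projective X] :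
    (monoQuasiIso A).rlp ⊓ quasiIso A _ ≤ (monomorphisms _).rlp := by
  rintro X Y p ⟨hp, hp'⟩
  obtain ⟨F⟩ := exists_factorization_monomorphisms p
  have hi : quasiIso A _ F.i := of_postcomp _ F.i F.p F.hp.2 (by rwa [F.fac])
  have := hp F.i ⟨F.hi, hi⟩
  exact of_retract (RetractArrow.ofRightLiftingProperty F.fac) F.hp.1

/-- The model structure on chain complexes in an abelian category all of whose objects are
projective: the cofibrations are the monomorphisms and the weak equivalences are the
quasi-isomorphisms. -/
@[reducible]
def modelCategory [∀ X : A, Projective X] : ModelCategory (ChainComplex A ℕ) :=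
  let c : CategoryWithCofibrations (ChainComplex A ℕ) := ⟨monomorphisms _⟩
  let w : CategoryWithWeakEquivalences (ChainComplex A ℕ) := ⟨quasiIso A _⟩
  let f : CategoryWithFibrations (ChainComplex A ℕ) := ⟨(monoQuasiIso A).rlp⟩
  { categoryWithCofibrations := c
    categoryWithWeakEquivalences := w
    categoryWithFibrations := f
    cm2 := inferInstanceAs (quasiIso A _).HasTwoOutOfThreeProperty
    cm3a := inferInstanceAs (quasiIso A _).IsStableUnderRetracts
    cm3b := inferInstanceAs (monoQuasiIso A).rlp.IsStableUnderRetracts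
    cm3c := inferInstanceAs (monomorphisms _).IsStableUnderRetracts
    cm4a := fun i p ⟨hi⟩ ⟨hw⟩ ⟨hp⟩ =>
      have hp' : (monoQuasiIso A).rlp p := hp
      hp' i ⟨hi, hw⟩
    cm4b := fun i p ⟨hi⟩ ⟨hp⟩ ⟨hw⟩ => rlp_inf_quasiIso_le A p ⟨hp, hw⟩ i hi
    cm5a := ⟨exists_factorization_monoQuasiIso⟩
    cm5b := ⟨fun f => by
      obtain ⟨F⟩ := exists_factorization_monomorphisms f
      exact ⟨{ F with hp := ⟨antitone_rlp inf_le_left _ F.hp.1, F.hp.2⟩ }⟩⟩ }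

end ChainComplex

/-! ### The model structure on simplicial vector spaces -/

lemma CategoryTheory.MorphismProperty.rlp_inverseImage_of_isEquivalence {C D : Type*} [Category* C]
    [Category* D] (F : C ⥤ D) [F.IsEquivalence] (W : MorphismProperty D) [W.RespectsIso] :
    (W.inverseImage F).rlp = W.rlp.inverseImage F := by
  ext X Y p
  refine ⟨fun hp A B i hi => ?_, fun hp A B i hi =>
    (F.hasLiftingProperty_iff_of_isEquivalence i p).1 (hp _ hi)⟩
  let e : CategoryTheory.Arrow.mk (F.map (F.inv.map i)) ≅ CategoryTheory.Arrow.mk i :=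
    ((Functor.mapArrowFunctor _ _).mapIso F.asEquivalence.counitIso).app (CategoryTheory.Arrow.mk i)
  have h : W (F.map (F.inv.map i)) := (W.arrow_mk_iso_iff e).2 hi
  have := (F.hasLiftingProperty_iff_of_isEquivalence _ p).2 (hp (F.inv.map i) h)
  exact HasLiftingProperty.of_arrow_iso_left e (F.map p)

namespace SimplicialVect

variable (k : Type u) [Field k]

lemma projective_moduleCat (V : ModuleCat.{u} k) : Projective V :=
  ModuleCat.projective_of_free (Module.Basis.ofVectorSpace k V)

open MorphismProperty in
lemma exists_isStandardModelStructure :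
    ∃ M : ModelCategory (SimplicialVect k), IsStandardModelStructure M := by
  have := projective_moduleCat k
  let := ChainComplex.modelCategory (ModuleCat.{u} k)
  let : CategoryWithCofibrations (SimplicialVect k) := ⟨monomorphisms _⟩
  let : CategoryWithWeakEquivalences (SimplicialVect k) := ⟨simplicialWeakEquivalences k⟩
  let : CategoryWithFibrations (SimplicialVect k) :=
    ⟨(monomorphisms _ ⊓ simplicialWeakEquivalences k).rlp⟩
  let e : SimplicialVect k ≌ ChainComplex (ModuleCat.{u} k) ℕ := Abelian.DoldKan.equivalence
  have h : monomorphisms (SimplicialVect k) = (monomorphisms _).inverseImage e.functor := by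
    ext X Y f
    exact (e.functor.mono_map_iff_mono f).symm
  refine ⟨ModelCategory.transport e h ?_ rfl, rfl, rfl, rfl⟩
  refine Eq.trans ?_ (rlp_inverseImage_of_isEquivalence e.functor (ChainComplex.monoQuasiIso _))
  exact congrArg (fun W => (W ⊓ simplicialWeakEquivalences k).rlp) h

end SimplicialVect

/-! ### Transfer of model structures to an ambient abelian category -/

namespace CategoryTheory.Adjunction

open Limits MorphismProperty

variable {C E : Type*} [Category* C] [Category* E] {L : C ⥤ E} {R : E ⥤ C} (adj : L ⊣ R)

/-- The left adjoint turns the lifting property against `p` into that against `R p`. -/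
lemma map_le_llp_inverseImage (adj : L ⊣ R) {W W' : MorphismProperty C}
    (h : ∀ ⦃A B X Y : C⦄ (i : A ⟶ B) (p : X ⟶ Y), W i → W' p → HasLiftingProperty i p) :
    W ≤ ((W'.inverseImage R).llp).inverseImage L :=
  fun _ _ i hi _ _ p hp => (adj.hasLiftingProperty_iff i p).2 (h i _ hi hp)

variable [Abelian C] [Abelian E]

/-- If `C` is a coreflective subcategory of `E`, with monic counit and exact inclusion `L`, then
the pushout of a monomorphism `L i : L (R X) ⟶ L A` along the counit has coreflection `A`. -/
lemma isIso_homEquiv_of_isPushout [L.Full] [L.Faithful] [L.Additive] [L.PreservesMonomorphisms]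
    [∀ Y, Mono (adj.counit.app Y)] {X P : E} {A : C} {i : R.obj X ⟶ A} [Mono i]
    {t : L.obj A ⟶ P} {j : X ⟶ P} (h : IsPushout (L.map i) (adj.counit.app X) t j) :
    IsIso (adj.homEquiv A P t) := by
  have hj : Mono j := Abelian.mono_inr_of_isColimit _ _ h.isColimit
  have ht : Mono t := Abelian.mono_inl_of_isColimit _ _ h.isColimit
  have : R.PreservesMonomorphisms := R.preservesMonomorphisms_of_adjunction adj
  have : Mono (adj.homEquiv A P t) := by
    rw [adj.homEquiv_unit]
    infer_instance
  -- the cokernel of `j` is the image under `L` of the cokernel of `i`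
  have hc : L.map i ≫ L.map (cokernel.π i) = 0 := by
    rw [← L.map_comp, cokernel.condition, L.map_zero]
  let c : P ⟶ L.obj (cokernel i) := h.desc (L.map (cokernel.π i)) 0 (by rw [hc, comp_zero])
  have tc : t ≫ c = L.map (cokernel.π i) := h.inl_desc _ _ _
  have jc : j ≫ c = 0 := h.inr_desc _ _ _
  let S := ShortComplex.mk j c jc
  have hS : S.Exact := by
    have := adj.leftAdjoint_preservesColimits
    have hS' : ((ShortComplex.mk i (cokernel.π i) (cokernel.condition i)).map L).Exact :=
      (ShortComplex.exact_of_g_is_cokernel _ (cokernelIsCokernel i)).map_of_epi_of_preservesCokernel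
        L (inferInstanceAs (Epi (cokernel.π i))) inferInstance
    have : Epi (L.map (cokernel.π i)) := inferInstance
    have : Epi ((ShortComplex.mk i (cokernel.π i) (cokernel.condition i)).map L).g := this
    have : Epi c := epi_of_epi_fac tc
    refine S.exact_of_g_is_cokernel (CokernelCofork.IsColimit.ofπ' c jc fun k hk => ?_)
    have hk' : L.map i ≫ t ≫ k = 0 := by rw [h.w_assoc, hk, comp_zero]
    let l : L.obj (cokernel i) ⟶ _ := hS'.desc (t ≫ k) hk'
    have hl : L.map (cokernel.π i) ≫ l = t ≫ k := hS'.g_desc _ _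
    refine ⟨l, h.hom_ext ?_ ?_⟩
    · rw [reassoc_of% tc, hl]
    · rw [reassoc_of% jc, hk, zero_comp]
  -- `c` induces a morphism `q : R P ⟶ coker i`; since `A ⟶ coker i` is an epimorphism, so is the
  -- projection `b` to `R P` of the pullback, and it suffices to factor `b` through `A ⟶ R P`
  let ε : L.obj (R.obj P) ⟶ P := adj.counit.app P
  let q := L.preimage (ε ≫ c)
  have hq : L.map q = ε ≫ c := L.map_preimage _
  let a := pullback.fst (cokernel.π i) q
  let b := pullback.snd (cokernel.π i) q
  have hab : a ≫ cokernel.π i = b ≫ q := pullback.condition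
  let x : L.obj (pullback (cokernel.π i) q) ⟶ X := hS.lift (L.map b ≫ ε - L.map a ≫ t) (by
    change (L.map b ≫ ε - L.map a ≫ t) ≫ c = 0
    rw [Preadditive.sub_comp, Category.assoc, Category.assoc, tc, ← hq, ← L.map_comp,
      ← L.map_comp, hab, sub_self])
  have hx : x ≫ j = L.map b ≫ ε - L.map a ≫ t := hS.lift_f _ _
  let x' := adj.homEquiv _ _ x
  have hx' : L.map x' ≫ adj.counit.app X = x :=
    (adj.homEquiv_counit _ _ x').symm.trans (Equiv.symm_apply_apply _ x)
  have key : L.map b ≫ ε = L.map (a + x' ≫ i) ≫ t := by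
    rw [L.map_add, L.map_comp, Preadditive.add_comp, Category.assoc, h.w, ← Category.assoc, hx', hx,
      add_sub_cancel]
  have key' : b = (a + x' ≫ i) ≫ adj.homEquiv A P t := by
    rw [← adj.homEquiv_naturality_left, ← key]
    exact (Equiv.apply_symm_apply (adj.homEquiv _ _) b).symm.trans
      (congrArg _ (adj.homEquiv_counit _ _ b))
  have : Epi (adj.homEquiv A P t) := epi_of_epi_fac key'.symm
  exact isIso_of_mono_of_epi _

/-- A factorization `i ≫ q` of `R f`, with `i` monic, lifts to a factorization `j ≫ g` of `f`
such that `j` is a pushout of `L i`. -/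
lemma exists_factorization_of_map [L.Full] [L.Faithful] [L.Additive] [L.PreservesMonomorphisms]
    [∀ Y, Mono (adj.counit.app Y)] {X Y : E} (f : X ⟶ Y) {A : C} (i : R.obj X ⟶ A)
    (q : A ⟶ R.obj Y) (fac : i ≫ q = R.map f) [Mono i] :
    ∃ (P : E) (t : L.obj A ⟶ P) (j : X ⟶ P) (g : P ⟶ Y),
      IsPushout (L.map i) (adj.counit.app X) t j ∧ j ≫ g = f ∧
      Nonempty (Arrow.mk i ≅ Arrow.mk (R.map j)) ∧ Nonempty (Arrow.mk q ≅ Arrow.mk (R.map g)) := by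
  have h := IsPushout.of_hasPushout (L.map i) (adj.counit.app X)
  let t := pushout.inl (L.map i) (adj.counit.app X)
  have w : L.map i ≫ (adj.homEquiv A Y).symm q = adj.counit.app X ≫ f := by
    rw [← adj.homEquiv_naturality_left_symm, fac, adj.homEquiv_counit]
    exact adj.counit.naturality f
  have := adj.isIso_homEquiv_of_isPushout h
  let e : A ≅ R.obj (pushout (L.map i) (adj.counit.app X)) := asIso (adj.homEquiv _ _ t)
  refine ⟨_, _, _, pushout.desc _ f w, h, pushout.inr_desc _ _ _, ⟨?_⟩, ⟨?_⟩⟩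
  · refine Arrow.isoMk (Iso.refl _) e ?_
    have : i ≫ adj.homEquiv _ _ t = R.map (pushout.inr (L.map i) (adj.counit.app X)) := by
      rw [← adj.homEquiv_naturality_left, h.w, adj.homEquiv_naturality_right, adj.homEquiv_unit,
        adj.right_triangle_components, Category.id_comp]
    exact (Category.id_comp _).trans this.symm
  · refine Arrow.isoMk e (Iso.refl _) ?_
    have : adj.homEquiv _ _ t ≫ R.map (pushout.desc _ f w) = q := by
      rw [← adj.homEquiv_naturality_right, pushout.inl_desc, Equiv.apply_symm_apply]
    exact this.trans (Category.comp_id _).symm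

/-- The model structure of a coreflective subcategory with exact inclusion and monic counit, in
which all cofibrations are monomorphisms, can be transferred along the coreflector. -/
theorem exists_isTransferred_isQuillenEquivalence (M : ModelCategory C) [L.Full] [L.Faithful]
    [L.Additive] [L.PreservesMonomorphisms] [IsIso adj.unit] [∀ Y, Mono (adj.counit.app Y)]
    (hM : cofibrations C ≤ monomorphisms C) :
    ∃ N : ModelCategory E, IsTransferred M N R ∧ IsQuillenEquivalence M N adj := by
  have hfac {X Y : E} (f : X ⟶ Y) {A : C} (i : R.obj X ⟶ A) (q : A ⟶ R.obj Y)
      (fac : i ≫ q = R.map f) (hi : cofibrations C i) := by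
    have : Mono i := hM _ hi
    exact adj.exists_factorization_of_map f i q fac
  have hL : cofibrations C ≤ (((trivialFibrations C).inverseImage R).llp).inverseImage L :=
    adj.map_le_llp_inverseImage fun _ _ _ _ i p hi hp => hasLiftingProperty_of_wfs i p hi hp
  have hL' : trivialCofibrations C ≤ (((fibrations C).inverseImage R).llp).inverseImage L :=
    adj.map_le_llp_inverseImage fun _ _ _ _ i p hi hp => hasLiftingProperty_of_wfs i p hi hp
  -- a trivial cofibration is a retract of a pushout of the image of one in `C`
  have key {A B : E} (i : A ⟶ B) (hi : ((trivialFibrations C).inverseImage R).llp i)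
      (hi' : weakEquivalences C (R.map i)) : ((fibrations C).inverseImage R).llp i := by
    let F := factorizationData (trivialCofibrations C) (fibrations C) (R.map i)
    obtain ⟨P, t, j, g, h, fac, ⟨e⟩, ⟨e'⟩⟩ := hfac i F.i F.p F.fac F.hi.1
    have hg : fibrations C (R.map g) := (arrow_mk_iso_iff _ e').1 F.hp
    have hj : weakEquivalences C (R.map j) := (arrow_mk_iso_iff _ e).1 F.hi.2
    have hg' : weakEquivalences C (R.map g) :=
      of_precomp _ (R.map j) _ hj (by rwa [← R.map_comp, fac])
    have := hi g ⟨hg, hg'⟩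
    exact of_retract (RetractArrow.ofLeftLiftingProperty fac) (of_isPushout h.flip (hL' _ F.hi))
  let c : CategoryWithCofibrations E := ⟨((trivialFibrations C).inverseImage R).llp⟩
  let w : CategoryWithWeakEquivalences E := ⟨(weakEquivalences C).inverseImage R⟩
  let f : CategoryWithFibrations E := ⟨(fibrations C).inverseImage R⟩
  let N : ModelCategory E :=
    { categoryWithCofibrations := c
      categoryWithWeakEquivalences := w
      categoryWithFibrations := f
      cm2 := inferInstanceAs ((weakEquivalences C).inverseImage R).HasTwoOutOfThreeProperty
      cm3a := inferInstanceAs ((weakEquivalences C).inverseImage R).IsStableUnderRetracts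
      cm3b := inferInstanceAs ((fibrations C).inverseImage R).IsStableUnderRetracts
      cm3c := inferInstanceAs ((trivialFibrations C).inverseImage R).llp.IsStableUnderRetracts
      cm4a := fun i p ⟨hi⟩ ⟨hw⟩ ⟨hp⟩ => key i hi hw p hp
      cm4b := fun i p ⟨hi⟩ ⟨hp⟩ ⟨hw⟩ =>
        have hi' : ((trivialFibrations C).inverseImage R).llp i := hi
        hi' p ⟨hp, hw⟩
      cm5a := ⟨fun f => by
        let F := factorizationData (trivialCofibrations C) (fibrations C) (R.map f)
        obtain ⟨P, t, j, g, h, fac, ⟨e⟩, ⟨e'⟩⟩ := hfac f F.i F.p F.fac F.hi.1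
        exact ⟨{
          Z := P
          i := j
          p := g
          fac := fac
          hi := ⟨of_isPushout (P := ((trivialFibrations C).inverseImage R).llp) h.flip
            (hL _ F.hi.1),
            (arrow_mk_iso_iff (weakEquivalences C) e).1 F.hi.2⟩
          hp := (arrow_mk_iso_iff (fibrations C) e').1 F.hp }⟩⟩
      cm5b := ⟨fun f => by
        let F := factorizationData (cofibrations C) (trivialFibrations C) (R.map f)
        obtain ⟨P, t, j, g, h, fac, ⟨e⟩, ⟨e'⟩⟩ := hfac f F.i F.p F.fac F.hi
        exact ⟨{
          Z := P
          i := j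
          p := g
          fac := fac
          hi := of_isPushout (P := ((trivialFibrations C).inverseImage R).llp) h.flip (hL _ F.hi)
          hp := (arrow_mk_iso_iff (trivialFibrations C) e').1 F.hp }⟩⟩ }
  refine ⟨N, ⟨rfl, rfl, rfl⟩, ⟨hL, fun X Y i hi => ⟨hL _ hi.1, ?_⟩, fun X Y _ _ f => ?_⟩⟩
  · exact (arrow_mk_iso_iff (weakEquivalences C) (Arrow.isoMk (asIso (adj.unit.app X))
      (asIso (adj.unit.app Y)) (adj.unit.naturality i).symm)).1 hi.2
  · rw [adj.homEquiv_unit]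
    have hη : weakEquivalences C (adj.unit.app X) := (weakEquivalences C).of_isIso _
    rw [weakEquivalence_iff, weakEquivalence_iff]
    exact ((weakEquivalences C).precomp_iff _ (R.map f) hη).symm

end CategoryTheory.Adjunction

/-! ### Restriction and coinduction -/

namespace CrossedSimplicialGroup.Projection

variable {D : CrossedSimplicialGroup.{v}} {k : Type u} [Field k] (p : D.Projection k)

/-- As `p` is surjective, the `ΔG`-module `Δ` of linear combinations of morphisms to `[n]` is
generated by the identity. -/
lemma bimodule_hom_ext_id {n : SimplexCategory} {Y : D.Mod k} {ψ ψ' : p.bimodule.obj n ⟶ Y}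
    (h : (ψ.app (op (D.of n))).hom (𝟙 (Free.of k n)) =
      (ψ'.app (op (D.of n))).hom (𝟙 (Free.of k n))) : ψ = ψ' := by
  refine p.bimodule_hom_ext fun c a => ?_
  induction a using free_induction with
  | zero => exact (map_zero (ψ.app c).hom).trans (map_zero (ψ'.app c).hom).symm
  | add a b ha hb =>
    exact (map_add (ψ.app c).hom a b).trans
      ((congrArg₂ (· + ·) ha hb).trans (map_add (ψ'.app c).hom a b).symm)
  | smul r a ha =>
    exact (map_smul (ψ.app c).hom r a).trans
      ((congrArg (r • ·) ha).trans (map_smul (ψ'.app c).hom r a).symm)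
  | of φ =>
    have key (χ : p.bimodule.obj n ⟶ Y) : (χ.app c).hom
        (freeHom k φ : Free.of k c.unop.as ⟶ Free.of k n) =
        (Y.map (Quiver.Hom.op (D.inclusion.map φ))).hom
          ((χ.app (op (D.of n))).hom (𝟙 (Free.of k n))) := by
      refine Eq.trans ?_ (congrArg (fun h => h.hom (𝟙 (Free.of k n)))
        (χ.naturality (Quiver.Hom.op (D.inclusion.map φ))))
      have e : freeHom k φ = p.functor.map (D.inclusion.map φ) ≫ 𝟙 (Free.of k n) :=
        (p.map_incl φ).symm.trans (Category.comp_id (p.functor.map (D.inclusion.map φ))).symm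
      exact congrArg (χ.app c).hom e
    rw [key, key, h]

instance : IsIso p.adj.unit := by
  have (X : SimplicialVect k) (n : SimplexCategoryᵒᵖ) : IsIso ((p.adj.unit.app X).app n) := by
    have e (x : X.obj n) : (SimplicialVect.act X (𝟙 (Free.of k n.unop))).hom x = x :=
      congrArg (fun h => h.hom x) (SimplicialVect.act_id X n.unop)
    rw [ConcreteCategory.isIso_iff_bijective]
    refine ⟨fun x y h => ?_, fun ψ => ?_⟩
    · have h' := congrArg (fun ψ : p.bimodule.obj n.unop ⟶ p.res.obj X =>
        (ψ.app (op (D.of n.unop))).hom (𝟙 (Free.of k n.unop))) h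
      exact (e x).symm.trans (h'.trans (e y))
    · let ψ' : p.bimodule.obj n.unop ⟶ p.res.obj X := ψ
      exact ⟨(ψ'.app (op (D.of n.unop))).hom (𝟙 (Free.of k n.unop)),
        p.bimodule_hom_ext_id (e _)⟩
  have (X : SimplicialVect k) : IsIso (p.adj.unit.app X) := NatIso.isIso_of_isIso_app _
  exact NatIso.isIso_of_isIso_app _

instance (Y : D.Mod k) : Mono (p.adj.counit.app Y) := by
  have (c : D.Catᵒᵖ) : Mono ((p.adj.counit.app Y).app c) := by
    rw [ModuleCat.mono_iff_injective]
    exact fun ψ ψ' h => p.bimodule_hom_ext_id h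
  exact NatTrans.mono_of_mono_app _

instance : p.res.Additive where

instance : p.res.PreservesMonomorphisms where
  preserves f _ := by
    have (c : D.Catᵒᵖ) : Mono ((p.res.map f).app c) :=
      inferInstanceAs (Mono (f.app (op c.unop.as)))
    exact NatTrans.mono_of_mono_app _

theorem exists_isTransferred_isQuillenEquivalence (M : ModelCategory (SimplicialVect k))
    (hM : IsStandardModelStructure M) :
    ∃ N : ModelCategory (D.Mod k), IsTransferred M N p.coind ∧ IsQuillenEquivalence M N p.adj := by
  have : p.res.Full := p.adj.fullyFaithfulLOfIsIsoUnit.full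
  have : p.res.Faithful := p.adj.fullyFaithfulLOfIsIsoUnit.faithful
  exact p.adj.exists_isTransferred_isQuillenEquivalence M hM.cofibrations_eq.le

end CrossedSimplicialGroup.Projection

end

theorem mainTheorem3 (k : Type u) [Field k] (D : CrossedSimplicialGroup.{v}) :
    Nonempty (D.Projection k) ∧
      ∃ M : ModelCategory (SimplicialVect k), IsStandardModelStructure M ∧
        ∀ p : D.Projection k, ∃ N : ModelCategory (D.Mod k),
          IsTransferred M N p.coind ∧ IsQuillenEquivalence M N p.adj := by
  obtain ⟨M, hM⟩ := SimplicialVect.exists_isStandardModelStructure k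
  exact ⟨D.nonempty_projection k, M, hM, fun p =>
    p.exists_isTransferred_isQuillenEquivalence M hM⟩
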